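/- An Artin graph $\Gamma=(V,E,m)$ is a simplicial graph with (possibly infinite) vertex set $V$, edge set $E$ and a labelling $m\colon E\to\{2,3,4,\dots\}$; it is even if all labels are even. Its Artin group is $$G_\Gamma=\langle V\mid \mathrm{prod}(u,v,m(\{u,v\}))=\mathrm{prod}(v,u,m(\{u,v\}))\ \ \forall\,\{u,v\}\in E\rangle,$$ where $\mathrm{prod}(u,v,n)$ is the prefix of length $n$ of the infinite alternating word $uvuvuv\cdots$. For $S\subseteq V$, let $G_S$ be the subgroup of $G_\Gamma$ generated by $S$. A subgroup of $G_\Gamma$ is parabolic over $S$ if it equals $gG_Sg^{-1}$ for some $g\in G_\Gamma$, and it is parabolic if it is parabolic over some $S\subseteq V$. For $x\in V$, let $\mathrm{st}(x)$ be the set consisting of $x$ and of all vertices joined to $x$ by an edge. Proposition. Let $\mathcal C$ be a class of even Artin graphs that is closed under taking induced subgraphs (with the restricted labelling) and satisfies the following base condition: for all $\Gamma\in\mathcal C$, $A\subseteq V$ and $g\in G_\Gamma$ such that $\mathrm{st}(x)=V$ for all $x\in V\setminus A$, either $G_A=gG_Ag^{-1}$, or $G_A\cap gG_Ag^{-1}\leqslant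 dG_Bd^{-1}$ for some $B\subsetneq A$ and some $d\in G_\Gamma$. Let $\Gamma\in\mathcal C$, and let $P$ and $Q$ be subgroups of $G_\Gamma$ that are parabolic over subsets $A$ and $B$ of $V$, respectively, where $A\cap B$ is finite (which is automatic if $\Gamma$ is finite). Then $P\cap Q$ is parabolic. In particular, if $\Gamma\in\mathcal C$ is finite, the intersection of any two parabolic subgroups of $G_\Gamma$ is parabolic. -/

import Mathlib

universe u

/-- An Artin graph with vertex type `V`: a simplicial graph together with a labelling of its edges
by integers at least `2`. The vertex type may be infinite. -/
structure ArtinGraph (V : Type u) where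
  /-- the underlying simplicial graph -/
  graph : SimpleGraph V
  /-- the labelling of the edges -/
  label : graph.edgeSet → ℕ
  two_le_label : ∀ e, 2 ≤ label e

/-- The prefix of length `n` of the infinite alternating product `u v u v u v ⋯`. -/
def altProd {M : Type*} [Monoid M] : M → M → ℕ → M
  | _, _, 0 => 1
  | u, v, n + 1 => u * altProd v u n

namespace ArtinGraph

variable {V : Type u} (Γ : ArtinGraph V)

/-- All the labels are even. -/
def IsEven : Prop := ∀ e, Even (Γ.label e)

/-- The link of a vertex. -/
def link (x : V) : Set V := {y | Γ.graph.Adj x y}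

/-- The star of a vertex. -/
def star (x : V) : Set V := Γ.link x ∪ {x}

/-- The Artin subgraph induced by a set `S` of vertices, with the restricted labelling. -/
def induce (S : Set V) : ArtinGraph S where
  graph := Γ.graph.induce S
  label e := Γ.label ⟨e.1.map Subtype.val, by
    obtain ⟨e, he⟩ := e
    induction e using Sym2.ind with
    | _ a b => simpa using he⟩
  two_le_label _ := Γ.two_le_label _

/-- The relators `prod(u,v,m) prod(v,u,m)⁻¹`, for the edges `{u,v}` with label `m`. -/
def relators : Set (FreeGroup V) :=
  {r | ∃ (u v : V) (h : Γ.graph.Adj u v),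
    r = altProd (FreeGroup.of u) (FreeGroup.of v) (Γ.label ⟨s(u, v), h⟩) *
      (altProd (FreeGroup.of v) (FreeGroup.of u) (Γ.label ⟨s(u, v), h⟩))⁻¹}

/-- The Artin group based on `Γ`. -/
abbrev ArtinGroup : Type u := PresentedGroup Γ.relators

/-- The standard generator of the Artin group given by a vertex. -/
def gen (v : V) : Γ.ArtinGroup := PresentedGroup.of v

/-- The standard parabolic subgroup `G_S`, generated by the vertices in `S`. -/
def standardParabolic (S : Set V) : Subgroup Γ.ArtinGroup := Subgroup.closure (Γ.gen '' S)

/-- The conjugate `g G_S g⁻¹` of a standard parabolic subgroup. -/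
def conjParabolic (g : Γ.ArtinGroup) (S : Set V) : Subgroup Γ.ArtinGroup :=
  (Γ.standardParabolic S).map (MulAut.conj g).toMonoidHom

/-- `K` is parabolic over `S`: it is a conjugate of `G_S`. -/
def IsParabolicOver (K : Subgroup Γ.ArtinGroup) (S : Set V) : Prop :=
  ∃ g : Γ.ArtinGroup, K = Γ.conjParabolic g S

/-- `K` is parabolic: it is a conjugate of some standard parabolic subgroup. -/
def IsParabolic (K : Subgroup Γ.ArtinGroup) : Prop :=
  ∃ S : Set V, Γ.IsParabolicOver K S

end ArtinGraph

/-- A class of Artin graphs (with vertex types in a fixed universe). -/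
abbrev ArtinGraphClass : Type (u + 1) := ∀ V : Type u, ArtinGraph V → Prop

namespace ArtinGraphClass

/-- All the graphs in the class are even. -/
def AllEven (C : ArtinGraphClass.{u}) : Prop :=
  ∀ (V : Type u) (Γ : ArtinGraph V), C V Γ → Γ.IsEven

/-- The class is closed under taking induced subgraphs. -/
def ClosedUnderSubgraphs (C : ArtinGraphClass.{u}) : Prop :=
  ∀ (V : Type u) (Γ : ArtinGraph V), C V Γ → ∀ S : Set V, C S (Γ.induce S)

/-- The base condition: for all `Γ` in the class, `A ⊆ V` and `g ∈ G_Γ` such that `st(x) = V` for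
all `x ∈ V - A`, either `G_A = g G_A g⁻¹`, or `G_A ∩ g G_A g⁻¹` is contained in `d G_B d⁻¹` for some
proper subset `B` of `A` and some `d ∈ G_Γ`. -/
def BaseCondition (C : ArtinGraphClass.{u}) : Prop :=
  ∀ (V : Type u) (Γ : ArtinGraph V), C V Γ →
    ∀ (A : Set V) (g : Γ.ArtinGroup), (∀ x, x ∉ A → Γ.star x = Set.univ) →
      Γ.standardParabolic A = Γ.conjParabolic g A ∨
      ∃ (B : Set V) (d : Γ.ArtinGroup), B ⊂ A ∧
        Γ.standardParabolic A ⊓ Γ.conjParabolic g A ≤ Γ.conjParabolic d B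

end ArtinGraphClass

/-! Evenness makes killing any set of vertices compatible with the relations, so every G_S is a
retract of G_Γ. Retracting puts an intersection of parabolics over A and B inside one over A ∩ B,
which reduces the claim to two conjugates of one G_D with D finite.

The core is `conjDichotomy`: either g normalises G_D, or G_D ∩ gG_Dg⁻¹ lies in a parabolic over a
proper subset of D. If every x ∉ D has st(x) = V, this is the base condition. Otherwise G_Γ splits
at some x as an amalgam of G_{V∖x} and G_{st(x)} over G_{lk(x)}, both on smaller graphs; normal
forms trap the intersection over lk(x) ∩ D or shorten g until it lies in a factor.
`isParabolic_inf_of_ncard` then concludes by induction on |A ∩ B|. -/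

theorem map_altProd {M N : Type*} [Monoid M] [Monoid N] (f : M →* N) (n : ℕ) (u v : M) :
    f (altProd u v n) = altProd (f u) (f v) n := by
  induction n generalizing u v with
  | zero => simp [altProd]
  | succ n ih => simp [altProd, ih]

theorem altProd_two_mul {M : Type*} [Monoid M] (u v : M) (k : ℕ) :
    altProd u v (2 * k) = (u * v) ^ k := by
  induction k with
  | zero => simp [altProd]
  | succ k ih => rw [show 2 * (k + 1) = 2 * k + 1 + 1 by ring, altProd, altProd, ih, pow_succ',
      mul_assoc]

/-- The point where even labels matter: a relation survives when one of its generators is sent to 1.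
-/
theorem altProd_comm_of_even {M : Type*} [Monoid M] {u v : M} (h : Commute u v) {n : ℕ}
    (hn : Even n) : altProd u v n = altProd v u n := by
  obtain ⟨k, rfl⟩ := hn
  rw [← two_mul, altProd_two_mul, altProd_two_mul, h.eq]

/-! ### Standard parabolic subgroups and retractions -/

namespace ArtinGraph

variable {V : Type u} (Γ : ArtinGraph V)

theorem altProd_gen {u v : V} (h : Γ.graph.Adj u v) :
    altProd (Γ.gen u) (Γ.gen v) (Γ.label ⟨s(u, v), h⟩) =
      altProd (Γ.gen v) (Γ.gen u) (Γ.label ⟨s(u, v), h⟩) := by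
  have h1 : PresentedGroup.mk Γ.relators (altProd (FreeGroup.of u) (FreeGroup.of v)
      (Γ.label ⟨s(u, v), h⟩) * (altProd (FreeGroup.of v) (FreeGroup.of u)
      (Γ.label ⟨s(u, v), h⟩))⁻¹) = 1 := PresentedGroup.one_of_mem ⟨u, v, h, rfl⟩
  rw [map_mul, map_inv, mul_inv_eq_one, map_altProd, map_altProd] at h1
  exact h1

/-- The homomorphism out of an Artin group given by a map that respects the relations. -/
def lift {G : Type*} [Group G] (f : V → G)
    (hf : ∀ (u v : V) (h : Γ.graph.Adj u v), altProd (f u) (f v) (Γ.label ⟨s(u, v), h⟩) =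
      altProd (f v) (f u) (Γ.label ⟨s(u, v), h⟩)) : Γ.ArtinGroup →* G :=
  PresentedGroup.toGroup (f := f) (by
    rintro r ⟨u, v, h, rfl⟩
    rw [map_mul, map_inv, mul_inv_eq_one, map_altProd, map_altProd]
    simpa using hf u v h)

@[simp]
theorem lift_gen {G : Type*} [Group G] (f : V → G) (hf) (v : V) :
    Γ.lift f hf (Γ.gen v) = f v :=
  PresentedGroup.toGroup.of _

theorem hom_ext {G : Type*} [Group G] {f g : Γ.ArtinGroup →* G}
    (h : ∀ v, f (Γ.gen v) = g (Γ.gen v)) : f = g :=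
  PresentedGroup.ext h

theorem closure_range_gen : Subgroup.closure (Set.range Γ.gen) = ⊤ :=
  PresentedGroup.closure_range_of _

theorem standardParabolic_univ : Γ.standardParabolic Set.univ = ⊤ := by
  rw [standardParabolic, Set.image_univ, closure_range_gen]

theorem standardParabolic_mono {S T : Set V} (h : S ⊆ T) :
    Γ.standardParabolic S ≤ Γ.standardParabolic T :=
  Subgroup.closure_mono (Set.image_mono h)

theorem gen_mem {S : Set V} {v : V} (h : v ∈ S) : Γ.gen v ∈ Γ.standardParabolic S :=
  Subgroup.subset_closure ⟨v, h, rfl⟩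

theorem mem_conjParabolic {g x : Γ.ArtinGroup} {S : Set V} :
    x ∈ Γ.conjParabolic g S ↔ g⁻¹ * x * g ∈ Γ.standardParabolic S := by
  rw [conjParabolic, Subgroup.mem_map]
  constructor
  · rintro ⟨y, hy, rfl⟩
    simpa [mul_assoc] using hy
  · intro h
    exact ⟨_, h, by simp [mul_assoc]⟩

/-- The homomorphism induced by the inclusion of an induced subgraph. -/
def incl (S : Set V) : (Γ.induce S).ArtinGroup →* Γ.ArtinGroup :=
  (Γ.induce S).lift (fun v => Γ.gen v) fun _ _ h => Γ.altProd_gen h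

@[simp]
theorem incl_gen (S : Set V) (v : S) : Γ.incl S ((Γ.induce S).gen v) = Γ.gen v :=
  lift_gen _ _ _ _

theorem map_incl_standardParabolic (S : Set V) (T : Set S) :
    ((Γ.induce S).standardParabolic T).map (Γ.incl S) =
      Γ.standardParabolic (Subtype.val '' T) := by
  rw [standardParabolic, standardParabolic, MonoidHom.map_closure, Set.image_image,
    Set.image_image]
  simp

theorem range_incl (S : Set V) : (Γ.incl S).range = Γ.standardParabolic S := by
  rw [MonoidHom.range_eq_map, ← standardParabolic_univ, map_incl_standardParabolic]
  simp

theorem map_incl_conjParabolic (S : Set V) (g : (Γ.induce S).ArtinGroup) (T : Set S) :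
    ((Γ.induce S).conjParabolic g T).map (Γ.incl S) =
      Γ.conjParabolic (Γ.incl S g) (Subtype.val '' T) := by
  rw [conjParabolic, conjParabolic, ← map_incl_standardParabolic, Subgroup.map_map,
    Subgroup.map_map]
  congr 1
  ext x
  simp

variable {Γ}

open Classical in
/-- The retraction of an even Artin group onto the Artin group of an induced subgraph. -/
noncomputable def retr (hE : Γ.IsEven) (S : Set V) : Γ.ArtinGroup →* (Γ.induce S).ArtinGroup :=
  Γ.lift (fun v => if h : v ∈ S then (Γ.induce S).gen ⟨v, h⟩ else 1) fun u v h => by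
    by_cases hu : u ∈ S
    · by_cases hv : v ∈ S
      · simp only [hu, hv, dif_pos]
        exact (Γ.induce S).altProd_gen (u := ⟨u, hu⟩) (v := ⟨v, hv⟩) h
      · simp only [hv, dif_neg, not_false_eq_true]
        exact altProd_comm_of_even (Commute.one_right _) (hE _)
    · simp only [hu, dif_neg, not_false_eq_true]
      exact altProd_comm_of_even (Commute.one_left _) (hE _)

theorem retr_gen_of_mem (hE : Γ.IsEven) {S : Set V} {v : V} (h : v ∈ S) :
    retr hE S (Γ.gen v) = (Γ.induce S).gen ⟨v, h⟩ := by
  simp [retr, h]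

theorem retr_gen_of_notMem (hE : Γ.IsEven) {S : Set V} {v : V} (h : v ∉ S) :
    retr hE S (Γ.gen v) = 1 := by
  simp [retr, h]

theorem retr_incl (hE : Γ.IsEven) (S : Set V) (g : (Γ.induce S).ArtinGroup) :
    retr hE S (Γ.incl S g) = g := by
  have : (retr hE S).comp (Γ.incl S) = MonoidHom.id _ :=
    hom_ext _ fun v => by simp [retr_gen_of_mem hE v.2]
  exact DFunLike.congr_fun this g

theorem incl_injective (hE : Γ.IsEven) (S : Set V) : Function.Injective (Γ.incl S) :=
  Function.LeftInverse.injective (retr_incl hE S)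

theorem incl_retr_of_mem (hE : Γ.IsEven) {S : Set V} {g : Γ.ArtinGroup}
    (h : g ∈ Γ.standardParabolic S) : Γ.incl S (retr hE S g) = g := by
  rw [← range_incl] at h
  obtain ⟨y, rfl⟩ := h
  rw [retr_incl]

theorem incl_retr_mem (hE : Γ.IsEven) (S : Set V) (g : Γ.ArtinGroup) :
    Γ.incl S (retr hE S g) ∈ Γ.standardParabolic S := by
  rw [← range_incl]
  exact ⟨_, rfl⟩

theorem incl_retr_mem_inter (hE : Γ.IsEven) {S T : Set V} {g : Γ.ArtinGroup}
    (h : g ∈ Γ.standardParabolic T) :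
    Γ.incl S (retr hE S g) ∈ Γ.standardParabolic (S ∩ T) := by
  suffices Γ.standardParabolic T ≤
      (Γ.standardParabolic (S ∩ T)).comap ((Γ.incl S).comp (retr hE S)) from this h
  rw [standardParabolic, Subgroup.closure_le]
  rintro _ ⟨v, hv, rfl⟩
  by_cases hS : v ∈ S
  · simpa [retr_gen_of_mem hE hS] using Γ.gen_mem (S := S ∩ T) ⟨hS, hv⟩
  · simp [retr_gen_of_notMem hE hS, one_mem]

/-- An intersection of parabolic subgroups over `A` and `B` lies in a parabolic subgroup over
`A ∩ B` of the first one. -/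
theorem exists_inf_le_conjParabolic_inter (hE : Γ.IsEven) (a b : Γ.ArtinGroup) (A B : Set V) :
    ∃ k ∈ Γ.standardParabolic A,
      Γ.conjParabolic a A ⊓ Γ.conjParabolic b B ≤ Γ.conjParabolic (a * k) (A ∩ B) := by
  -- The conjugator k is the image of a⁻¹b under the retraction onto G_A. That retraction fixes
  -- a⁻¹pa and sends G_B into G_{A ∩ B}.
  refine ⟨_, incl_retr_mem hE A (a⁻¹ * b), ?_⟩
  intro p hp
  have hpA := (mem_conjParabolic _).1 (Subgroup.mem_inf.1 hp).1
  have hpB := (mem_conjParabolic _).1 (Subgroup.mem_inf.1 hp).2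
  rw [mem_conjParabolic]
  have h1 := incl_retr_mem_inter hE (S := A) hpB
  have h2 := incl_retr_of_mem hE hpA
  have h3 : b⁻¹ * p * b = (a⁻¹ * b)⁻¹ * (a⁻¹ * p * a) * (a⁻¹ * b) := by group
  rw [h3] at h1
  generalize a⁻¹ * b = c at *
  simp only [map_mul, map_inv] at h1 h2
  rw [h2] at h1
  convert h1 using 1
  group

theorem gen_ne_one (hE : Γ.IsEven) (v : V) : Γ.gen v ≠ 1 := by
  classical
  intro h
  have := congrArg (Γ.lift (fun w => if w = v then Multiplicative.ofAdd (1 : ℤ) else 1)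
    fun _ _ _ => altProd_comm_of_even (Commute.all _ _) (hE _)) h
  simp at this

theorem IsEven.induce (hE : Γ.IsEven) (S : Set V) : (Γ.induce S).IsEven := fun _ => hE _

/-- Killing B kills every conjugate of G_B, but no generator outside B. -/
theorem subset_of_conjParabolic_le (hE : Γ.IsEven) {h d : Γ.ArtinGroup} {E B : Set V}
    (hle : Γ.conjParabolic h E ≤ Γ.conjParabolic d B) : E ⊆ B := by
  intro v hv
  by_contra hvB
  have h1 : h * Γ.gen v * h⁻¹ ∈ Γ.conjParabolic d B :=
    hle ((mem_conjParabolic _).2 (by simpa [mul_assoc] using Γ.gen_mem hv))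
  rw [mem_conjParabolic] at h1
  have h2 : Γ.standardParabolic B ≤ (retr hE Bᶜ).ker := by
    rw [standardParabolic, Subgroup.closure_le]
    rintro _ ⟨w, hw, rfl⟩
    exact retr_gen_of_notMem hE (by simpa using hw)
  have h3 := MonoidHom.mem_ker.1 (h2 h1)
  apply gen_ne_one (hE.induce Bᶜ) ⟨v, hvB⟩
  rw [← retr_gen_of_mem hE]
  have h4 := congrArg (fun y => (retr hE Bᶜ (h⁻¹ * d)) * y * (retr hE Bᶜ (h⁻¹ * d))⁻¹) h3
  simp only [← map_mul, ← map_inv] at h4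
  simpa [mul_assoc] using h4

theorem exists_finite_mem_standardParabolic (g : Γ.ArtinGroup) :
    ∃ S : Set V, S.Finite ∧ g ∈ Γ.standardParabolic S := by
  have hg : g ∈ Subgroup.closure (Set.range Γ.gen) := by simp [closure_range_gen]
  induction hg using Subgroup.closure_induction with
  | mem x hx =>
    obtain ⟨v, rfl⟩ := hx
    exact ⟨{v}, Set.finite_singleton v, Γ.gen_mem rfl⟩
  | one => exact ⟨∅, Set.finite_empty, one_mem _⟩
  | mul x y _ _ hx hy =>
    obtain ⟨S, hS, hx⟩ := hx
    obtain ⟨T, hT, hy⟩ := hy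
    exact ⟨S ∪ T, hS.union hT, mul_mem (Γ.standardParabolic_mono Set.subset_union_left hx)
      (Γ.standardParabolic_mono Set.subset_union_right hy)⟩
  | inv x _ hx =>
    obtain ⟨S, hS, hx⟩ := hx
    exact ⟨S, hS, inv_mem hx⟩

end ArtinGraph

/-! ### Alternating words and normal forms in amalgams -/

/-- `AltWord H Z b n g` says that `g` is a product of `n` letters, alternately from `H b \ Z` and
`H (!b) \ Z`, the first of them from `H b \ Z`. -/
inductive AltWord {G : Type*} [Group G] (H : Bool → Subgroup G) (Z : Subgroup G) :
    Bool → ℕ → G → Prop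
  | single {b : Bool} {h : G} : h ∈ H b → h ∉ Z → AltWord H Z b 1 h
  | cons {b : Bool} {n : ℕ} {h r : G} : h ∈ H b → h ∉ Z → AltWord H Z (!b) n r →
      AltWord H Z b (n + 1) (h * r)

namespace AltWord

variable {G : Type*} [Group G] {H : Bool → Subgroup G} {Z : Subgroup G} {b : Bool} {n : ℕ}
  {g r h : G}

theorem mul_left (hZ : ∀ b, Z ≤ H b) (hr : AltWord H Z b n r) (hz : h ∈ Z) :
    AltWord H Z b n (h * r) := by
  cases hr with
  | single h1 h2 =>
    exact single (mul_mem (hZ _ hz) h1) fun h3 => h2 ((Z.mul_mem_cancel_left hz).1 h3)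
  | cons h1 h2 h3 =>
    rw [← mul_assoc]
    exact cons (mul_mem (hZ _ hz) h1) (fun h3 => h2 ((Z.mul_mem_cancel_left hz).1 h3)) h3

/-- Every element of the group generated by the two factors is in `Z` or an alternating word. -/
theorem mem_or_exists (hZ : ∀ b, Z ≤ H b) (hg : g ∈ H true ⊔ H false) :
    g ∈ Z ∨ ∃ b n, AltWord H Z b n g := by
  have key : ∀ b, ∀ x ∈ H b, ∀ y, (y ∈ Z ∨ ∃ b n, AltWord H Z b n y) →
      (x * y ∈ Z ∨ ∃ b n, AltWord H Z b n (x * y)) := by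
    intro b x hx y hy
    by_cases hxZ : x ∈ Z
    · rcases hy with hy | ⟨c, n, hy⟩
      · exact Or.inl (mul_mem hxZ hy)
      · exact Or.inr ⟨c, n, hy.mul_left hZ hxZ⟩
    rcases hy with hy | ⟨c, n, hy⟩
    · exact Or.inr ⟨b, 1, single (mul_mem hx (hZ b hy))
        fun h3 => hxZ ((Z.mul_mem_cancel_right hy).1 h3)⟩
    by_cases hc : c = b
    · subst hc
      cases hy with
      | single h1 h2 =>
        by_cases h3 : x * y ∈ Z
        · exact Or.inl h3
        · exact Or.inr ⟨_, _, single (mul_mem hx h1) h3⟩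
      | @cons _ _ h r h1 h2 h4 =>
        rw [← mul_assoc]
        by_cases h3 : x * h ∈ Z
        · exact Or.inr ⟨_, _, h4.mul_left hZ h3⟩
        · exact Or.inr ⟨_, _, cons (mul_mem hx h1) h3 h4⟩
    · obtain rfl : c = !b := by cases b <;> cases c <;> simp_all
      exact Or.inr ⟨_, _, cons hx hxZ hy⟩
  have hg' : g ∈ Subgroup.closure ((H true : Set G) ∪ H false) := by
    rwa [← Subgroup.sup_eq_closure]
  induction hg' using Subgroup.closure_induction_left with
  | one => exact Or.inl (one_mem _)
  | mul_left x hx y hy ih =>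
    have hy' : y ∈ H true ⊔ H false := by rwa [Subgroup.sup_eq_closure]
    rcases hx with hx | hx
    · exact key true x hx y (ih hy')
    · exact key false x hx y (ih hy')
  | inv_mul_cancel x hx y hy ih =>
    have hy' : y ∈ H true ⊔ H false := by rwa [Subgroup.sup_eq_closure]
    rcases hx with hx | hx
    · exact key true _ (inv_mem hx) y (ih hy')
    · exact key false _ (inv_mem hx) y (ih hy')

/-- Multiplying on the right by an element of one factor changes only the end of the word. The first
factor can be lost only when a single letter is absorbed into `Z`. -/
theorem mul_right_aux (hZ : ∀ b, Z ≤ H b) (hr : AltWord H Z b n r) {c : Bool} {a : G}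
    (ha : a ∈ H c) :
    (b = c ∧ r * a ∈ Z) ∨ ∃ m, AltWord H Z b m (r * a) := by
  induction hr with
  | @single b h h1 h2 =>
    by_cases hb : b = c
    · subst hb
      by_cases h3 : h * a ∈ Z
      · exact Or.inl ⟨rfl, h3⟩
      · exact Or.inr ⟨_, single (mul_mem h1 ha) h3⟩
    · obtain rfl : c = !b := by cases b <;> cases c <;> simp_all
      by_cases h3 : a ∈ Z
      · exact Or.inr ⟨_, single (mul_mem h1 (hZ _ h3))
          fun h4 => h2 ((Z.mul_mem_cancel_right h3).1 h4)⟩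
      · exact Or.inr ⟨_, cons h1 h2 (single ha h3)⟩
  | @cons b n h r h1 h2 h4 ih =>
    rw [mul_assoc]
    rcases ih with ⟨_, h3⟩ | ⟨m, hm⟩
    · exact Or.inr ⟨_, single (mul_mem h1 (hZ _ h3))
        fun h5 => h2 ((Z.mul_mem_cancel_right h3).1 h5)⟩
    · exact Or.inr ⟨_, cons h1 h2 hm⟩

theorem mul_right (hZ : ∀ b, Z ≤ H b) (hr : AltWord H Z (!b) n r) (ha : h ∈ H b) :
    ∃ m, AltWord H Z (!b) m (r * h) := by
  rcases hr.mul_right_aux hZ ha with ⟨h1, _⟩ | h1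
  · simp at h1
  · exact h1

/-- The two words start in different factors, so nothing cancels at the junction. -/
theorem inv_mul {k : G} {m : ℕ} (hg : AltWord H Z b n g) (hk : AltWord H Z (!b) m k) :
    ∃ c l, AltWord H Z c l (g⁻¹ * k) := by
  induction hg generalizing m k with
  | single h1 h2 => exact ⟨_, _, cons (inv_mem h1) (by simpa using h2) hk⟩
  | cons h1 h2 h3 ih =>
    rw [mul_inv_rev, mul_assoc]
    refine ih (k := _) (m := m + 1) ?_
    rw [Bool.not_not]
    exact cons (inv_mem h1) (by simpa using h2) hk

variable (hZ : ∀ b, Z ≤ H b)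
  (f : G →* Monoid.PushoutI fun b => Subgroup.inclusion (hZ b))
  (hf : ∀ b (h : H b), f h = Monoid.PushoutI.of b h)

include hf

theorem exists_word (hg : AltWord H Z b n g) :
    ∃ w : Monoid.CoprodI.Word fun b => H b, w.fstIdx = some b ∧
      Monoid.PushoutI.Reduced (fun b => Subgroup.inclusion (hZ b)) w ∧
      Monoid.PushoutI.ofCoprodI w.prod = f g := by
  have hred : ∀ {b : Bool} {h : G} (h1 : h ∈ H b), h ∉ Z →
      (⟨h, h1⟩ : H b) ∉ (Subgroup.inclusion (hZ b)).range := by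
    rintro b h h1 h2 ⟨z, hz⟩
    have hz' : (z : G) = h := congrArg Subtype.val hz
    exact h2 (hz' ▸ z.2)
  have hne : ∀ {b : Bool} {h : G} (h1 : h ∈ H b), h ∉ Z → (⟨h, h1⟩ : H b) ≠ 1 := by
    intro b h h1 h2 h3
    have h4 : h = 1 := congrArg Subtype.val h3
    exact h2 (h4 ▸ one_mem Z)
  induction hg with
  | @single b h h1 h2 =>
    refine ⟨.cons (⟨h, h1⟩ : H b) .empty nofun (hne h1 h2),
      Monoid.CoprodI.Word.fstIdx_cons .., ?_, ?_⟩
    · intro x hx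
      simp only [Monoid.CoprodI.Word.cons, Monoid.CoprodI.Word.empty, List.mem_singleton] at hx
      subst hx
      exact hred h1 h2
    · rw [Monoid.CoprodI.Word.prod_cons, map_mul, Monoid.PushoutI.ofCoprodI_of,
        Monoid.CoprodI.Word.prod_empty, map_one, mul_one]
      exact (hf b ⟨h, h1⟩).symm
  | @cons b n h r h1 h2 h3 ih =>
    obtain ⟨w, hw1, hw2, hw3⟩ := ih
    refine ⟨.cons (⟨h, h1⟩ : H b) w (by simp [hw1]) (hne h1 h2), by simp, ?_, ?_⟩
    · intro x hx
      simp only [Monoid.CoprodI.Word.cons, List.mem_cons] at hx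
      rcases hx with rfl | hx
      · exact hred h1 h2
      · exact hw2 x hx
    · simp [hw3, ← hf b ⟨h, h1⟩]

/-- By the normal form theorem, a nonempty reduced word of the pushout is not in the base. Only a
homomorphism to the pushout that is compatible with the factors is needed, not an isomorphism. -/
theorem notMem (hg : AltWord H Z b n g) : g ∉ Z := by
  intro hgZ
  obtain ⟨w, hw1, hw2, hw3⟩ := hg.exists_word hZ f hf
  have := hw2.eq_empty_of_mem_range (fun b => Subgroup.inclusion_injective (hZ b))
    ⟨⟨g, hgZ⟩, by
      rw [hw3, ← Monoid.PushoutI.of_apply_eq_base _ b]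
      exact (hf b ⟨g, hZ b hgZ⟩).symm⟩
  rw [this] at hw1
  simp [Monoid.CoprodI.Word.fstIdx, Monoid.CoprodI.Word.empty] at hw1

theorem not_of_not {m : ℕ} (hg : AltWord H Z b n g) : ¬ AltWord H Z (!b) m g := by
  intro hg'
  obtain ⟨c, l, h⟩ := hg.inv_mul hg'
  exact h.notMem hZ f hf (by simp [one_mem])

/-- If `a ∈ H b` is conjugate to `a'` by `h * r`, where `h ∈ H b` and both `r` and `r * a'` are
alternating words that start in the other factor, then `a` lies in `h Z h⁻¹`. -/
theorem inv_mul_mul_mem {a a' : G} {m : ℕ} (ha : a ∈ H b) (hh : h ∈ H b)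
    (hr : AltWord H Z (!b) n r) (hra : AltWord H Z (!b) m (r * a'))
    (heq : a * (h * r) = h * r * a') : h⁻¹ * a * h ∈ Z := by
  by_contra hn
  have h1 : AltWord H Z b (n + 1) (h⁻¹ * a * h * r) :=
    cons (mul_mem (mul_mem (inv_mem hh) ha) hh) hn hr
  rw [show h⁻¹ * a * h * r = r * a' by
    rw [mul_assoc h⁻¹, mul_assoc h⁻¹, mul_assoc a, heq]; group] at h1
  exact h1.not_of_not hZ f hf hra

end AltWord

/-! ### The splitting of an Artin group at a vertex -/

namespace ArtinGraph
variable {V : Type u} {Γ : ArtinGraph V}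

/-- The factors of the decomposition of an Artin group as an amalgam over the link of `x`. -/
def factor (Γ : ArtinGraph V) (x : V) : Bool → Set V
  | true => {x}ᶜ
  | false => Γ.star x

theorem link_subset_factor (x : V) (b : Bool) : Γ.link x ⊆ Γ.factor x b := by
  cases b
  · exact Set.subset_union_left
  · intro y hy hyx
    rw [Set.mem_singleton_iff] at hyx
    subst hyx
    exact Γ.graph.irrefl hy

theorem link_le_factor (x : V) (b : Bool) :
    Γ.standardParabolic (Γ.link x) ≤ Γ.standardParabolic (Γ.factor x b) :=
  Γ.standardParabolic_mono (link_subset_factor x b)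

/-- Every edge lies inside one factor: in the star if it contains x, in the complement of x
otherwise. Hence each relation can be checked in a factor. -/
theorem exists_hom_pushoutI (Γ : ArtinGraph V) (x : V) :
    ∃ f : Γ.ArtinGroup →* Monoid.PushoutI fun b => Subgroup.inclusion (Γ.link_le_factor x b),
      ∀ b (h : Γ.standardParabolic (Γ.factor x b)), f h = Monoid.PushoutI.of b h := by
  classical
  let F : V → Monoid.PushoutI fun b => Subgroup.inclusion (Γ.link_le_factor x b) := fun v =>
    if h : v = x then Monoid.PushoutI.of (φ := fun b => Subgroup.inclusion (Γ.link_le_factor x b))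
      false ⟨Γ.gen v, Γ.gen_mem (Or.inr h)⟩
    else Monoid.PushoutI.of (φ := fun b => Subgroup.inclusion (Γ.link_le_factor x b))
      true ⟨Γ.gen v, Γ.gen_mem h⟩
  have hF : ∀ b v (h : v ∈ Γ.factor x b), F v = Monoid.PushoutI.of b
      ⟨Γ.gen v, Γ.gen_mem h⟩ := by
    intro b v h
    by_cases hv : v = x
    · cases b
      · simp only [F, dif_pos hv]
      · exact absurd hv h
    · cases b
      · have hl : v ∈ Γ.link x := h.resolve_right hv
        have e1 := Monoid.PushoutI.of_apply_eq_base
          (fun b => Subgroup.inclusion (Γ.link_le_factor x b)) true ⟨Γ.gen v, Γ.gen_mem hl⟩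
        have e2 := Monoid.PushoutI.of_apply_eq_base
          (fun b => Subgroup.inclusion (Γ.link_le_factor x b)) false ⟨Γ.gen v, Γ.gen_mem hl⟩
        simp only [F, dif_neg hv]
        exact e1.trans e2.symm
      · simp only [F, dif_neg hv]
  have hrel : ∀ b u v (h : Γ.graph.Adj u v), u ∈ Γ.factor x b → v ∈ Γ.factor x b →
      altProd (F u) (F v) (Γ.label ⟨s(u, v), h⟩) = altProd (F v) (F u) (Γ.label ⟨s(u, v), h⟩) := by
    intro b u v h hu hv
    rw [hF b u hu, hF b v hv, ← map_altProd, ← map_altProd]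
    congr 1
    apply Subtype.ext
    rw [← Subgroup.subtype_apply, ← Subgroup.subtype_apply, map_altProd, map_altProd]
    exact Γ.altProd_gen h
  refine ⟨Γ.lift F fun u v h => ?_, ?_⟩
  · by_cases hu : u = x
    · subst hu
      exact hrel false u v h (Or.inr rfl) (Or.inl h)
    · by_cases hv : v = x
      · subst hv
        exact hrel false u v h (Or.inl h.symm) (Or.inr rfl)
      · exact hrel true u v h hu hv
  · rintro b ⟨h, hh⟩
    induction hh using Subgroup.closure_induction with
    | mem y hy =>
      obtain ⟨v, hv, rfl⟩ := hy
      simpa using hF b v hv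
    | one => exact (map_one _).trans (map_one _).symm
    | mul y z hy hz ihy ihz =>
      refine (map_mul _ _ _).trans ?_
      rw [ihy, ihz, ← map_mul]
      rfl
    | inv y hy ih =>
      refine (map_inv _ _).trans ?_
      rw [ih, ← map_inv]
      rfl

theorem factor_sup (x : V) : Γ.standardParabolic (Γ.factor x true) ⊔
    Γ.standardParabolic (Γ.factor x false) = ⊤ := by
  rw [standardParabolic, standardParabolic, ← Subgroup.closure_union, ← Set.image_union,
    show Γ.factor x true ∪ Γ.factor x false = Set.univ from ?_]
  · exact Γ.standardParabolic_univ
  · ext y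
    by_cases h : y = x <;> simp [factor, star, h]

end ArtinGraph

/-! ### The dichotomy for conjugates of one standard parabolic -/

namespace ArtinGraph
variable {V : Type u} {Γ : ArtinGraph V}

/-- Either `g` normalises `G_A`, or `G_A ∩ g G_A g⁻¹` lies in a conjugate of `G_B` for a proper
subset `B` of `A`. -/
def ConjDichotomy (Γ : ArtinGraph V) (A : Set V) (g : Γ.ArtinGroup) : Prop :=
  Γ.standardParabolic A = Γ.conjParabolic g A ∨
    ∃ (B : Set V) (d : Γ.ArtinGroup), B ⊂ A ∧
      Γ.standardParabolic A ⊓ Γ.conjParabolic g A ≤ Γ.conjParabolic d B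

theorem conjParabolic_one (A : Set V) : Γ.conjParabolic 1 A = Γ.standardParabolic A := by
  ext x
  simp [mem_conjParabolic]

theorem mem_conjParabolic_mul {k g x : Γ.ArtinGroup} {A : Set V} :
    x ∈ Γ.conjParabolic (k * g) A ↔ k⁻¹ * x * k ∈ Γ.conjParabolic g A := by
  simp [mem_conjParabolic, mul_assoc]

theorem ConjDichotomy.mul {A : Set V} {k g : Γ.ArtinGroup}
    (hk : Γ.standardParabolic A = Γ.conjParabolic k A) (hg : Γ.ConjDichotomy A g) :
    Γ.ConjDichotomy A (k * g) := by
  have hk' : ∀ x, x ∈ Γ.standardParabolic A ↔ k⁻¹ * x * k ∈ Γ.standardParabolic A := fun x => by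
    rw [← mem_conjParabolic, ← hk]
  rcases hg with h | ⟨B, d, hB, h⟩
  · left
    ext x
    rw [mem_conjParabolic_mul, ← h]
    exact hk' x
  · refine Or.inr ⟨B, k * d, hB, fun x hx => ?_⟩
    rw [Subgroup.mem_inf, mem_conjParabolic_mul] at hx
    rw [mem_conjParabolic_mul]
    exact h ⟨(hk' x).1 hx.1, hx.2⟩

theorem ConjDichotomy.of_induce (hE : Γ.IsEven) {S A : Set V} (hA : A ⊆ S)
    (h : ∀ A' g', (Γ.induce S).ConjDichotomy A' g') {g : Γ.ArtinGroup}
    (hg : g ∈ Γ.standardParabolic S) : Γ.ConjDichotomy A g := by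
  rw [← range_incl] at hg
  obtain ⟨g', rfl⟩ := hg
  obtain ⟨A', rfl⟩ : ∃ A' : Set S, Subtype.val '' A' = A :=
    ⟨Subtype.val ⁻¹' A, by simpa using hA⟩
  rw [ConjDichotomy, ← map_incl_standardParabolic, ← map_incl_conjParabolic,
    ← Subgroup.map_inf _ _ _ (incl_injective hE S)]
  rcases h A' g' with h | ⟨B, d, hB, h⟩
  · exact Or.inl (by rw [h])
  · refine Or.inr ⟨_, Γ.incl S d, Subtype.val_injective.image_strictMono hB, ?_⟩
    rw [← map_incl_conjParabolic]
    exact Subgroup.map_mono h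

/-- For a in the intersection, a(hr) = (hr)a' with a' in G_A. Comparing normal forms gives h⁻¹ah ∈
G_{lk(x)}, and a retraction cuts lk(x) down to lk(x) ∩ A. -/
theorem exists_inf_le_conjParabolic_link (hE : Γ.IsEven) {x : V} {A : Set V} {b : Bool} {n : ℕ}
    {h r : Γ.ArtinGroup} (hA : A ⊆ Γ.factor x b) (hh : h ∈ Γ.standardParabolic (Γ.factor x b))
    (hr : AltWord (fun b => Γ.standardParabolic (Γ.factor x b))
      (Γ.standardParabolic (Γ.link x)) (!b) n r) :
    ∃ k ∈ Γ.standardParabolic (Γ.link x), Γ.standardParabolic A ⊓ Γ.conjParabolic (h * r) A ≤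
      Γ.conjParabolic (h * k) (Γ.link x ∩ A) := by
  obtain ⟨k, hk, hle⟩ := exists_inf_le_conjParabolic_inter hE h 1 (Γ.link x) A
  refine ⟨k, hk, le_trans (fun a ha => ?_) hle⟩
  obtain ⟨f, hf⟩ := exists_hom_pushoutI Γ x
  obtain ⟨ha1, ha2⟩ := Subgroup.mem_inf.1 ha
  rw [mem_conjParabolic] at ha2
  refine Subgroup.mem_inf.2 ⟨?_, by rwa [conjParabolic_one]⟩
  obtain ⟨m, hm⟩ := hr.mul_right (Γ.link_le_factor x) (Γ.standardParabolic_mono hA ha2)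
  rw [mem_conjParabolic]
  exact AltWord.inv_mul_mul_mem (Γ.link_le_factor x) f hf (Γ.standardParabolic_mono hA ha1) hh hr
    hm (by group)

theorem conjDichotomy_of_altWord (hE : Γ.IsEven) {x : V} {A : Set V} (hA : A ⊆ Γ.link x)
    (hfac : ∀ b, ∀ g ∈ Γ.standardParabolic (Γ.factor x b), Γ.ConjDichotomy A g) {b : Bool} {n : ℕ}
    {g : Γ.ArtinGroup} (hg : AltWord (fun b => Γ.standardParabolic (Γ.factor x b))
      (Γ.standardParabolic (Γ.link x)) b n g) : Γ.ConjDichotomy A g := by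
  induction n generalizing b g with
  | zero => cases hg
  | succ n ih =>
    cases hg with
    | single h1 _ => exact hfac b g h1
    | @cons _ _ h r h1 _ h3 =>
      obtain ⟨k, hk, hle⟩ := exists_inf_le_conjParabolic_link hE
        (hA.trans (link_subset_factor x b)) h1 h3
      rw [Set.inter_eq_right.2 hA] at hle
      -- Since hk lies in a factor, the dichotomy holds for it. If hk normalises G_A it can be
      -- stripped off, leaving the shorter word k⁻¹r.
      rcases hfac b (h * k) (mul_mem h1 (Γ.link_le_factor x b hk)) with he | ⟨B, d, hB, hd⟩
      · have := ConjDichotomy.mul he (ih (h3.mul_left (Γ.link_le_factor x) (inv_mem hk)))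
        rwa [show h * k * (k⁻¹ * r) = h * r by group] at this
      · exact Or.inr ⟨B, d, hB, le_trans (le_inf inf_le_left hle) hd⟩

theorem conjDichotomy_of_factor (hE : Γ.IsEven) {x : V} {A : Set V} (hx : x ∉ A)
    (hfac : ∀ b, A ⊆ Γ.factor x b → ∀ g ∈ Γ.standardParabolic (Γ.factor x b),
      Γ.ConjDichotomy A g) (g : Γ.ArtinGroup) : Γ.ConjDichotomy A g := by
  have hxA : A ⊆ Γ.factor x true := fun y hy hyx => hx (Set.mem_singleton_iff.1 hyx ▸ hy)
  have hgen := AltWord.mem_or_exists (H := fun b => Γ.standardParabolic (Γ.factor x b))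
    (Γ.link_le_factor x) (g := g) (by rw [factor_sup]; trivial)
  by_cases hA : A ⊆ Γ.link x
  · have hfac' := fun b => hfac b (hA.trans (link_subset_factor x b))
    rcases hgen with hg | ⟨b, n, hg⟩
    · exact hfac' true g (Γ.link_le_factor x true hg)
    · exact conjDichotomy_of_altWord hE hA hfac' hg
  · have key : ∀ {n : ℕ} {h r : Γ.ArtinGroup}, h ∈ Γ.standardParabolic (Γ.factor x true) →
        AltWord (fun b => Γ.standardParabolic (Γ.factor x b))
          (Γ.standardParabolic (Γ.link x)) false n r → Γ.ConjDichotomy A (h * r) := by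
      intro n h r hh hr
      obtain ⟨k, _, hle⟩ := exists_inf_le_conjParabolic_link hE hxA hh hr
      refine Or.inr ⟨_, _, ⟨Set.inter_subset_right, fun h => hA fun y hy => (h hy).1⟩, hle⟩
    rcases hgen with hg | ⟨b, n, hg⟩
    · exact hfac true hxA g (Γ.link_le_factor x true hg)
    · cases b with
      -- A word starting in the star factor gets the first letter h = 1.
      | false => simpa using key (one_mem _) hg
      | true =>
        cases hg with
        | single h1 _ => exact hfac true hxA g h1
        | cons h1 _ h3 => exact key h1 h3

theorem conjDichotomy_of_finite {C : ArtinGraphClass.{u}} (hEven : C.AllEven)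
    (hSub : C.ClosedUnderSubgraphs) (hBase : C.BaseCondition) (n : ℕ) :
    ∀ (V : Type u) (Γ : ArtinGraph V), C V Γ → Finite V → Nat.card V = n →
      ∀ (A : Set V) (g : Γ.ArtinGroup), Γ.ConjDichotomy A g := by
  induction n using Nat.strong_induction_on with
  | _ n ih =>
    intro V Γ hΓ hfin hn A g
    by_cases hst : ∀ x, x ∉ A → Γ.star x = Set.univ
    · exact hBase V Γ hΓ A g hst
    · push Not at hst
      obtain ⟨x, hx, hst⟩ := hst
      refine conjDichotomy_of_factor (hEven V Γ hΓ) hx (fun b hA g hg => ?_) g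
      refine ConjDichotomy.of_induce (hEven V Γ hΓ) hA
        (ih _ ?_ _ _ (hSub V Γ hΓ _) inferInstance rfl) hg
      -- Both factors omit a vertex: the star because st(x) ≠ V, the other because it omits x.
      rw [← hn, Nat.card_coe_set_eq, ← Set.ncard_univ]
      refine Set.ncard_lt_ncard (Set.ssubset_univ_iff.2 ?_)
      cases b
      · exact hst
      · exact fun h => (h ▸ Set.mem_univ x : x ∈ Γ.factor x true) rfl

theorem conjDichotomy {C : ArtinGraphClass.{u}} (hEven : C.AllEven)
    (hSub : C.ClosedUnderSubgraphs) (hBase : C.BaseCondition) (hΓ : C V Γ) {A : Set V}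
    (hA : A.Finite) (g : Γ.ArtinGroup) : Γ.ConjDichotomy A g := by
  obtain ⟨S, hS, hg⟩ := exists_finite_mem_standardParabolic g
  have : Finite ↑(A ∪ S) := hA.union hS
  exact ConjDichotomy.of_induce (hEven V Γ hΓ) Set.subset_union_left
    (conjDichotomy_of_finite hEven hSub hBase _ _ _ (hSub V Γ hΓ _) this rfl)
    (Γ.standardParabolic_mono Set.subset_union_right hg)

/-! ### Induction on the size of the intersection of the two vertex sets -/

theorem isParabolic_inf_of_ncard {C : ArtinGraphClass.{u}} (hEven : C.AllEven)
    (hSub : C.ClosedUnderSubgraphs) (hBase : C.BaseCondition) (hΓ : C V Γ) (n : ℕ) :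
    ∀ (A B : Set V) (a b : Γ.ArtinGroup), (A ∩ B).Finite → (A ∩ B).ncard = n →
      Γ.IsParabolic (Γ.conjParabolic a A ⊓ Γ.conjParabolic b B) := by
  have hE := hEven V Γ hΓ
  induction n using Nat.strong_induction_on with
  | _ n ih =>
    -- Retracting from both sides shows that P ∩ Q equals an intersection of two parabolics over D =
    -- A ∩ B.
    suffices main : ∀ (D : Set V) (a b : Γ.ArtinGroup), D.Finite → D.ncard = n →
        Γ.IsParabolic (Γ.conjParabolic a D ⊓ Γ.conjParabolic b D) by
      intro A B a b hfin hn
      obtain ⟨k, hk, hle⟩ := exists_inf_le_conjParabolic_inter hE a b A B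
      obtain ⟨l, hl, hle'⟩ := exists_inf_le_conjParabolic_inter hE b a B A
      have h1 : Γ.conjParabolic (a * k) (A ∩ B) ≤ Γ.conjParabolic a A := fun y hy => by
        have h2 := Γ.standardParabolic_mono Set.inter_subset_left
          ((mem_conjParabolic _).1 (mem_conjParabolic_mul.1 hy))
        rw [mem_conjParabolic]
        simpa [mul_assoc] using mul_mem (mul_mem hk h2) (inv_mem hk)
      have h1' : Γ.conjParabolic (b * l) (A ∩ B) ≤ Γ.conjParabolic b B := fun y hy => by
        have h2 := Γ.standardParabolic_mono Set.inter_subset_right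
          ((mem_conjParabolic _).1 (mem_conjParabolic_mul.1 hy))
        rw [mem_conjParabolic]
        simpa [mul_assoc] using mul_mem (mul_mem hl h2) (inv_mem hl)
      rw [Set.inter_comm B A, inf_comm] at hle'
      rw [le_antisymm (le_inf hle hle') (inf_le_inf h1 h1')]
      exact main _ _ _ hfin hn
    intro D a b hfin hn
    rcases conjDichotomy hEven hSub hBase hΓ hfin (a⁻¹ * b) with h | ⟨B, d, hB, h⟩
    · refine ⟨D, a, inf_eq_left.2 fun y hy => ?_⟩
      rw [mem_conjParabolic, h, ← mem_conjParabolic_mul] at hy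
      simpa using hy
    · have hK : Γ.conjParabolic a D ⊓ Γ.conjParabolic b D ≤ Γ.conjParabolic (a * d) B := by
        intro y hy
        rw [mem_conjParabolic_mul]
        refine h (Subgroup.mem_inf.2 ⟨(mem_conjParabolic _).1 hy.1, ?_⟩)
        rw [← mem_conjParabolic_mul]
        simpa using hy.2
      have hlt : ∀ E ⊆ B, (E ∩ D).Finite ∧ (E ∩ D).ncard < n := fun E hEB =>
        ⟨hfin.subset Set.inter_subset_right, hn ▸ Set.ncard_lt_ncard
          ((Set.inter_subset_left.trans hEB).trans_ssubset hB) hfin⟩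
      -- With K the parabolic over B ⊊ D containing P ∩ Q, write P ∩ Q = (K ∩ P) ∩ Q. The induction
      -- hypothesis makes K ∩ P parabolic over some E. Since E ⊆ B, it applies again to the
      -- intersection with Q.
      obtain ⟨E, e, he⟩ := ih _ (hlt B subset_rfl).2 B D (a * d) a (hlt B subset_rfl).1 rfl
      have hEB : E ⊆ B := subset_of_conjParabolic_le hE (he ▸ inf_le_left)
      have := ih _ (hlt E hEB).2 E D e b (hlt E hEB).1 rfl
      rwa [← he, inf_assoc, inf_eq_right.2 hK] at this

end ArtinGraph

theorem mainTheorem4 (C : ArtinGraphClass.{u}) (hEven : C.AllEven)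
    (hSub : C.ClosedUnderSubgraphs) (hBase : C.BaseCondition)
    (V : Type u) (Γ : ArtinGraph V) (hΓ : C V Γ)
    (A B : Set V) (hAB : (A ∩ B).Finite) (P Q : Subgroup Γ.ArtinGroup)
    (hP : Γ.IsParabolicOver P A) (hQ : Γ.IsParabolicOver Q B) :
    Γ.IsParabolic (P ⊓ Q) := by
  obtain ⟨a, rfl⟩ := hP
  obtain ⟨b, rfl⟩ := hQ
  exact ArtinGraph.isParabolic_inf_of_ncard hEven hSub hBase hΓ _ A B a b hAB rfl
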